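/- Let $q$ be a prime power. A $(2,1)$-blocking set in the projective space $\mathrm{PG}(n,q)$ over $\mathbb{F}_q$ is a set of lines such that every plane of $\mathrm{PG}(n,q)$ contains at least one line of the set. Let $f(n,q)$ denote the smallest possible size of a $(2,1)$-blocking set in $\mathrm{PG}(n,q)$. Then for every $n\ge 4$, $$f(n,q)\ \ge\ (q^{n+1}-1)(q^n-1)\cdot\frac{q^4+2q^2+q+1}{(q^5-1)(q^4-1)}.$$ In particular, for every $n\ge 5$, $$f(n,q)\ \ge\ q^{2n-4}+2q^{2n-6}+q^{2n-7}+2q^{2n-8}.$$ -/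

import Mathlib

/-- An `(s, t)`-blocking set of the projective space of the `K`-vector space `V`: a set of projective
`t`-spaces (vector subspaces of dimension `t + 1`) such that every projective `s`-space (vector
subspace of dimension `s + 1`) contains at least one of them. -/
def IsBlockingSet (K : Type*) [Field K] (V : Type*) [AddCommGroup V] [Module K V] (s t : ℕ)
    (B : Set (Submodule K V)) : Prop :=
  (∀ L ∈ B, Module.finrank K L = t + 1) ∧
    ∀ P : Submodule K V, Module.finrank K P = s + 1 → ∃ L ∈ B, L ≤ P

/-- `f(n, q)` for the finite field `K` with `q` elements: the smallest size of a `(2, 1)`-blocking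
set (lines blocking all planes) in `PG(n, q)`, the projective space of `K ^ (n + 1)`. -/
noncomputable def minLineBlocking (K : Type*) [Field K] (n : ℕ) : ℕ :=
  sInf {m : ℕ | ∃ B : Finset (Submodule K (Fin (n + 1) → K)),
    IsBlockingSet K (Fin (n + 1) → K) 2 1 (B : Set (Submodule K (Fin (n + 1) → K))) ∧ B.card = m}

/-- Over a finite field blocking sets exist, so the minimum is attained. -/
theorem exists_card_eq_minLineBlocking (K : Type*) [Field K] [Finite K] (n : ℕ) :
    ∃ B : Finset (Submodule K (Fin (n + 1) → K)),
      IsBlockingSet K (Fin (n + 1) → K) 2 1 (B : Set (Submodule K (Fin (n + 1) → K))) ∧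
        B.card = minLineBlocking K n := by
  classical
  refine Nat.sInf_mem (s := {m : ℕ | ∃ B : Finset (Submodule K (Fin (n + 1) → K)),
    IsBlockingSet K (Fin (n + 1) → K) 2 1 (B : Set (Submodule K (Fin (n + 1) → K))) ∧
      B.card = m}) ?_
  have hfin : Finite (Submodule K (Fin (n + 1) → K)) :=
    Finite.of_injective (fun L => (L : Set (Fin (n + 1) → K))) SetLike.coe_injective
  have hS : {L : Submodule K (Fin (n + 1) → K) | Module.finrank K L = 2}.Finite := Set.toFinite _
  refine ⟨_, hS.toFinset, ⟨fun L hL => by simpa using hL, fun P hP => ?_⟩, rfl⟩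
  obtain ⟨v, hv⟩ := exists_linearIndependent_of_le_finrank (R := K) (M := P) (n := 2) (by omega)
  have hL : Module.finrank K (Submodule.span K (Set.range v)) = 2 := by
    simpa using finrank_span_eq_card hv
  refine ⟨(Submodule.span K (Set.range v)).map P.subtype, ?_, Submodule.map_subtype_le P _⟩
  have h2 := (Submodule.finrank_map_subtype_eq P (Submodule.span K (Set.range v))).trans hL
  simpa using h2

/-! ### Counting subspaces of given dimension in an interval. -/

section Counting

open scoped Classical

variable {K V : Type*} [Field K] [AddCommGroup V] [Module K V] [Finite V]

/-! Everything rests on the case n = 4, `BlocksPlanesOf.le_card`. The general bound follows by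
averaging it over all 4-spaces U (`BlocksPlanesOf.mul_le_card_mul`), since the lines of B inside U
block the planes of U.

For n = 4 suppose |B| ≤ q^4 + 2q^2 + q. Relative to a point P, the lines of B are the d lines on P,
the bound lines and the free lines. A plane on P with no line of B on P must be spanned by P and a
free line, so there are at least (q^2 + 1 - d)(q^2 + q + 1) free lines. This forces d ≥ q at every
point, and averaging over the points yields a P with d = q.

Each of the q lines on P carries q further points, and the other lines of B at these points are
bound. Weighing the bound lines against the free ones forces the q lines into one plane E
(`exists_plane`) and makes all the estimates tight (`boundLines_structure`): E contains exactly q^2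
lines of B, and each free plane contains exactly one free line. A solid on E then contains at most
q^2 + q lines of B, which `lt_card_lines_in_solid` excludes. -/

instance finite_submodule_of_finite : Finite (Submodule K V) :=
  Finite.of_injective (fun L => (L : Set V)) SetLike.coe_injective

/-- The `d`-dimensional subspaces between `A` and `C`. -/
noncomputable def subspacesBetween (A C : Submodule K V) (d : ℕ) : Finset (Submodule K V) :=
  (Set.toFinite {X : Submodule K V | A ≤ X ∧ X ≤ C ∧ Module.finrank K X = d}).toFinset

@[simp]
theorem mem_subspacesBetween {A C X : Submodule K V} {d : ℕ} :
    X ∈ subspacesBetween A C d ↔ A ≤ X ∧ X ≤ C ∧ Module.finrank K X = d := by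
  simp [subspacesBetween]

theorem finrank_sup_span_singleton {A : Submodule K V} {v : V} (hv : v ∉ A) :
    Module.finrank K ↥(A ⊔ Submodule.span K {v}) = Module.finrank K A + 1 := by
  have hv0 : v ≠ 0 := fun h => hv (h ▸ A.zero_mem)
  have h := Submodule.finrank_sup_add_finrank_inf_eq A (Submodule.span K {v})
  rw [finrank_span_singleton hv0,
    ((Submodule.disjoint_span_singleton' hv0).2 hv).eq_bot, finrank_bot] at h
  exact h

theorem card_mem_sdiff {A C : Submodule K V} (hAC : A ≤ C) :
    (Set.toFinite {v : V | v ∈ C ∧ v ∉ A}).toFinset.card =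
      Nat.card K ^ Module.finrank K C - Nat.card K ^ Module.finrank K A := by
  rw [← Set.ncard_eq_toFinset_card _ (Set.toFinite _)]
  have : {v : V | v ∈ C ∧ v ∉ A} = (C : Set V) \ (A : Set V) := rfl
  rw [this, Set.ncard_sdiff hAC (Set.toFinite _), ← Module.natCard_eq_pow_finrank,
    ← Module.natCard_eq_pow_finrank]
  rfl

/-- Counting flags `A ≤ X ≤ Y ≤ C`. -/
theorem card_subspacesBetween_mul {A C : Submodule K V} {d e r s : ℕ}
    (hr : ∀ X ∈ subspacesBetween A C d, (subspacesBetween X C e).card = r)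
    (hs : ∀ Y ∈ subspacesBetween A C e, (subspacesBetween A Y d).card = s) :
    (subspacesBetween A C d).card * r = (subspacesBetween A C e).card * s := by
  refine Finset.card_mul_eq_card_mul (fun X Y => X ≤ Y) (fun X hX => ?_) (fun Y hY => ?_)
  · rw [← hr X hX]
    congr 1
    ext Y
    simp only [Finset.mem_bipartiteAbove, mem_subspacesBetween] at hX ⊢
    exact ⟨fun h => ⟨h.2, h.1.2⟩, fun h => ⟨⟨hX.1.trans h.1, h.2⟩, h.1⟩⟩
  · rw [← hs Y hY]
    congr 1
    ext X
    simp only [Finset.mem_bipartiteBelow, mem_subspacesBetween] at hY ⊢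
    exact ⟨fun h => ⟨h.1.1, h.2, h.1.2.2⟩, fun h => ⟨⟨h.1, h.2.1.trans hY.2.1, h.2.2⟩, h.2.1⟩⟩

variable [Finite K]

/-- The subspaces between `A` and `C` of dimension one more than that of `A` are the points of the
projective space of `C / A`. -/
theorem card_subspacesBetween_succ {A C : Submodule K V} (hAC : A ≤ C) {a m : ℕ}
    (ha : Module.finrank K A = a) (hc : Module.finrank K C = a + m) :
    (subspacesBetween A C (a + 1)).card = ∑ i ∈ Finset.range m, Nat.card K ^ i := by
  have hq : 2 ≤ Nat.card K := Finite.one_lt_card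
  have h := Finset.card_eq_sum_card_fiberwise
    (s := (Set.toFinite {v : V | v ∈ C ∧ v ∉ A}).toFinset) (t := subspacesBetween A C (a + 1))
    (f := fun v => A ⊔ Submodule.span K {v}) (by
      intro v hv
      simp only [Set.Finite.coe_toFinset, Set.mem_ofPred_eq] at hv
      simp only [Finset.mem_coe, mem_subspacesBetween]
      refine ⟨le_sup_left, sup_le hAC ?_, by rw [finrank_sup_span_singleton hv.2, ha]⟩
      simpa using hv.1)
  -- The vectors outside A that generate X over A are exactly those of X \ A, so all fibres have the
  -- same size.
  have hfib : ∀ X ∈ subspacesBetween A C (a + 1),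
      ((Set.toFinite {v : V | v ∈ C ∧ v ∉ A}).toFinset.filter
        (fun v => A ⊔ Submodule.span K {v} = X)).card = Nat.card K ^ (a + 1) - Nat.card K ^ a := by
    intro X hX
    obtain ⟨h1, h2, h3⟩ := mem_subspacesBetween.1 hX
    rw [← ha, show Module.finrank K A + 1 = Module.finrank K X by omega, ← card_mem_sdiff h1]
    congr 1
    ext v
    simp only [Finset.mem_filter, Set.Finite.mem_toFinset, Set.mem_ofPred_eq]
    constructor
    · rintro ⟨⟨-, hvA⟩, rfl⟩
      exact ⟨Submodule.mem_sup_right (Submodule.mem_span_singleton_self v), hvA⟩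
    · rintro ⟨hvX, hvA⟩
      refine ⟨⟨h2 hvX, hvA⟩, Submodule.eq_of_le_of_finrank_eq (sup_le h1 (by simpa using hvX)) ?_⟩
      rw [finrank_sup_span_singleton hvA]; omega
  rw [Finset.sum_congr rfl hfib, Finset.sum_const, card_mem_sdiff hAC, ha, hc, smul_eq_mul] at h
  have hg := Nat.geomSum_eq hq m
  have h1 : Nat.card K ^ (a + 1) - Nat.card K ^ a = Nat.card K ^ a * (Nat.card K - 1) := by
    rw [Nat.mul_sub, pow_succ, mul_one]
  have h2 : Nat.card K ^ (a + m) - Nat.card K ^ a = Nat.card K ^ a * (Nat.card K ^ m - 1) := by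
    rw [Nat.mul_sub, pow_add, mul_one]
  rw [h1, h2, mul_left_comm] at h
  have h3 := Nat.eq_of_mul_eq_mul_left (by positivity) h
  rw [hg, h3]
  exact (Nat.mul_div_cancel _ (by omega)).symm

theorem card_subspacesBetween_add_two {A C : Submodule K V} (hAC : A ≤ C) {a m : ℕ}
    (ha : Module.finrank K A = a) (hc : Module.finrank K C = a + (m + 1)) :
    (subspacesBetween A C (a + 2)).card * (Nat.card K + 1) =
      (∑ i ∈ Finset.range (m + 1), Nat.card K ^ i) * ∑ i ∈ Finset.range m, Nat.card K ^ i := by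
  rw [← card_subspacesBetween_succ hAC ha hc]
  symm
  refine card_subspacesBetween_mul (fun X hX => ?_) (fun Y hY => ?_)
  · obtain ⟨h1, h2, h3⟩ := mem_subspacesBetween.1 hX
    exact card_subspacesBetween_succ h2 h3 (by omega)
  · obtain ⟨h1, h2, h3⟩ := mem_subspacesBetween.1 hY
    rw [card_subspacesBetween_succ h1 ha h3]
    simp [Finset.sum_range_succ, add_comm]

/-- The number of lines of a projective plane, or of planes on a point of a projective 3-space. -/
theorem card_subspacesBetween_add_two_of_three {A C : Submodule K V} (hAC : A ≤ C) {a : ℕ}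
    (ha : Module.finrank K A = a) (hc : Module.finrank K C = a + 3) :
    (subspacesBetween A C (a + 2)).card = Nat.card K ^ 2 + Nat.card K + 1 := by
  have h := card_subspacesBetween_add_two hAC (m := 2) ha hc
  simp only [Finset.sum_range_succ, Finset.sum_range_zero] at h
  refine Nat.eq_of_mul_eq_mul_right (Nat.succ_pos (Nat.card K)) ?_
  rw [Nat.succ_eq_add_one, h]; ring

/-- The number of lines of a projective 3-space, or of planes on a point of a projective
4-space. -/
theorem card_subspacesBetween_add_two_of_four {A C : Submodule K V} (hAC : A ≤ C) {a : ℕ}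
    (ha : Module.finrank K A = a) (hc : Module.finrank K C = a + 4) :
    (subspacesBetween A C (a + 2)).card =
      (Nat.card K ^ 2 + 1) * (Nat.card K ^ 2 + Nat.card K + 1) := by
  have h := card_subspacesBetween_add_two hAC (m := 3) ha hc
  simp only [Finset.sum_range_succ, Finset.sum_range_zero] at h
  refine Nat.eq_of_mul_eq_mul_right (Nat.succ_pos (Nat.card K)) ?_
  rw [Nat.succ_eq_add_one, h]; ring

/-- The number of planes of a projective 3-space. -/
theorem card_subspacesBetween_bot_three {C : Submodule K V} (hc : Module.finrank K C = 4) :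
    (subspacesBetween ⊥ C 3).card = (Nat.card K ^ 2 + 1) * (Nat.card K + 1) := by
  have h := card_subspacesBetween_mul (A := ⊥) (C := C) (d := 2) (e := 3) (r := Nat.card K + 1)
    (s := Nat.card K ^ 2 + Nat.card K + 1) (fun X hX => by
      obtain ⟨h1, h2, h3⟩ := mem_subspacesBetween.1 hX
      rw [card_subspacesBetween_succ h2 h3 (m := 2) (by omega)]
      simp [Finset.sum_range_succ, add_comm]) (fun Y hY => by
      obtain ⟨h1, h2, h3⟩ := mem_subspacesBetween.1 hY
      exact card_subspacesBetween_add_two_of_three h1 (finrank_bot K V) (by omega))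
  rw [card_subspacesBetween_add_two_of_four bot_le (a := 0) (finrank_bot K V) (by omega)] at h
  refine Nat.eq_of_mul_eq_mul_right (Nat.succ_pos (Nat.card K ^ 2 + Nat.card K)) ?_
  rw [Nat.succ_eq_add_one, ← h]; ring

end Counting

/-! ### Incidence of points, lines and planes. -/

section Incidence

variable {K V : Type*} [Field K] [AddCommGroup V] [Module K V] [Finite V]

theorem finrank_point_sup_line {P L : Submodule K V} (hP : Module.finrank K P = 1)
    (hL : Module.finrank K L = 2) (h : ¬ P ≤ L) : Module.finrank K ↥(P ⊔ L) = 3 := by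
  have h1 := Submodule.finrank_sup_add_finrank_inf_eq P L
  have h2 : Module.finrank K ↥(P ⊓ L) < Module.finrank K P :=
    Submodule.finrank_lt_finrank_of_lt (inf_lt_left.2 h)
  omega

theorem inf_lines_eq {P L M : Submodule K V} (hP : Module.finrank K P = 1)
    (hL : Module.finrank K L = 2) (hM : Module.finrank K M = 2) (hLM : L ≠ M) (h1 : P ≤ L)
    (h2 : P ≤ M) : L ⊓ M = P := by
  have hlt : Module.finrank K ↥(L ⊓ M) < Module.finrank K L := by
    refine Submodule.finrank_lt_finrank_of_lt (inf_lt_left.2 fun h => hLM ?_)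
    exact Submodule.eq_of_le_of_finrank_eq h (by omega)
  exact (Submodule.eq_of_le_of_finrank_le (le_inf h1 h2) (by omega)).symm

theorem finrank_sup_lines {P L M : Submodule K V} (hP : Module.finrank K P = 1)
    (hL : Module.finrank K L = 2) (hM : Module.finrank K M = 2) (hLM : L ≠ M) (h1 : P ≤ L)
    (h2 : P ≤ M) : Module.finrank K ↥(L ⊔ M) = 3 := by
  have h := Submodule.finrank_sup_add_finrank_inf_eq L M
  rw [inf_lines_eq hP hL hM hLM h1 h2] at h
  omega

theorem sup_points_eq {P Q L : Submodule K V} (hP : Module.finrank K P = 1)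
    (hQ : Module.finrank K Q = 1) (hL : Module.finrank K L = 2) (hPQ : P ≠ Q) (h1 : P ≤ L)
    (h2 : Q ≤ L) : P ⊔ Q = L := by
  refine Submodule.eq_of_le_of_finrank_le (sup_le h1 h2) ?_
  have hlt : P < P ⊔ Q := left_lt_sup.2 fun h =>
    hPQ (Submodule.eq_of_le_of_finrank_eq h (by omega)).symm
  have := Submodule.finrank_lt_finrank_of_lt hlt
  omega

/-- A plane is spanned by any two of its lines on a common point. -/
theorem sup_lines_eq {P L M E : Submodule K V} (hP : Module.finrank K P = 1)
    (hL : Module.finrank K L = 2) (hM : Module.finrank K M = 2) (hLM : L ≠ M) (h1 : P ≤ L)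
    (h2 : P ≤ M) (hE : Module.finrank K E = 3) (hLE : L ≤ E) (hME : M ≤ E) : L ⊔ M = E :=
  Submodule.eq_of_le_of_finrank_eq (sup_le hLE hME)
    ((finrank_sup_lines hP hL hM hLM h1 h2).trans hE.symm)

end Incidence

/-! ### Point degrees of a small blocking set in a 4-space. -/

section Blocking

open scoped Classical

variable {K V : Type*} [Field K] [AddCommGroup V] [Module K V]

/-- The lines of `B` on the point `P`. -/
noncomputable def linesThrough (B : Finset (Submodule K V)) (P : Submodule K V) :
    Finset (Submodule K V) :=
  B.filter (P ≤ ·)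

/-- The lines of `B` off `P` that span together with `P` a plane containing a line of `B` on
`P`. -/
noncomputable def boundLines (B : Finset (Submodule K V)) (P : Submodule K V) :
    Finset (Submodule K V) :=
  B.filter fun M => ¬ P ≤ M ∧ ∃ L ∈ linesThrough B P, L ≤ P ⊔ M

/-- The lines of `B` off `P` that span together with `P` a plane containing no line of `B` on
`P`. -/
noncomputable def freeLines (B : Finset (Submodule K V)) (P : Submodule K V) :
    Finset (Submodule K V) :=
  B.filter fun M => ¬ P ≤ M ∧ ∀ L ∈ linesThrough B P, ¬ L ≤ P ⊔ M

@[simp]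
theorem mem_linesThrough {B : Finset (Submodule K V)} {P L : Submodule K V} :
    L ∈ linesThrough B P ↔ L ∈ B ∧ P ≤ L := by
  simp [linesThrough]

theorem mem_boundLines {B : Finset (Submodule K V)} {P M : Submodule K V} :
    M ∈ boundLines B P ↔ M ∈ B ∧ ¬ P ≤ M ∧ ∃ L ∈ linesThrough B P, L ≤ P ⊔ M := by
  simp [boundLines]

theorem mem_freeLines {B : Finset (Submodule K V)} {P M : Submodule K V} :
    M ∈ freeLines B P ↔ M ∈ B ∧ ¬ P ≤ M ∧ ∀ L ∈ linesThrough B P, ¬ L ≤ P ⊔ M := by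
  simp [freeLines]

theorem card_linesThrough_add (B : Finset (Submodule K V)) (P : Submodule K V) :
    (linesThrough B P).card + (boundLines B P).card + (freeLines B P).card = B.card := by
  have h1 := B.card_filter_add_card_filter_not (P ≤ ·)
  have h2 := (B.filter (¬ P ≤ ·)).card_filter_add_card_filter_not
    (fun M => ∃ L ∈ linesThrough B P, L ≤ P ⊔ M)
  rw [Finset.filter_filter, Finset.filter_filter] at h2
  simp only [not_exists, not_and] at h2
  rw [← h1, ← h2, add_assoc]
  rfl

/-- A set `B` of lines of the subspace `U` such that every plane of `U` contains a line of `B`. -/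
structure BlocksPlanesOf (B : Finset (Submodule K V)) (U : Submodule K V) : Prop where
  finrank_eq : ∀ L ∈ B, Module.finrank K L = 2
  le : ∀ L ∈ B, L ≤ U
  exists_le : ∀ E ≤ U, Module.finrank K E = 3 → ∃ L ∈ B, L ≤ E

theorem BlocksPlanesOf.filter_le {B : Finset (Submodule K V)} (h : BlocksPlanesOf B ⊤)
    (U : Submodule K V) : BlocksPlanesOf (B.filter (· ≤ U)) U where
  finrank_eq L hL := h.finrank_eq L (Finset.mem_of_mem_filter L hL)
  le L hL := (Finset.mem_filter.1 hL).2
  exists_le E hEU hE := by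
    obtain ⟨L, hL, hLE⟩ := h.exists_le E le_top hE
    exact ⟨L, Finset.mem_filter.2 ⟨hL, hLE.trans hEU⟩, hLE⟩

variable [Finite V]

/-- The planes on `P` in `C` containing no line of `B` on `P`. -/
noncomputable def freePlanes (B : Finset (Submodule K V)) (P C : Submodule K V) :
    Finset (Submodule K V) :=
  (subspacesBetween P C 3).filter fun E => ∀ L ∈ linesThrough B P, ¬ L ≤ E

theorem mem_freePlanes {B : Finset (Submodule K V)} {P C E : Submodule K V} :
    E ∈ freePlanes B P C ↔
      (P ≤ E ∧ E ≤ C ∧ Module.finrank K E = 3) ∧ ∀ L ∈ linesThrough B P, ¬ L ≤ E := by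
  simp [freePlanes]

namespace BlocksPlanesOf

variable {B : Finset (Submodule K V)} {U P : Submodule K V}

/-- The line of B blocking a free plane E cannot pass through P, so together with P it spans E. -/
theorem freePlanes_subset (h : BlocksPlanesOf B U) (hP : Module.finrank K P = 1) :
    freePlanes B P U ⊆ (freeLines B P).image (P ⊔ ·) := by
  intro E hE
  obtain ⟨⟨h1, h2, h3⟩, h4⟩ := mem_freePlanes.1 hE
  obtain ⟨M, hM, hME⟩ := h.exists_le E h2 h3
  have hPM : ¬ P ≤ M := fun hPM => h4 M (by simp [hM, hPM]) hME
  have hE' : P ⊔ M = E := Submodule.eq_of_le_of_finrank_eq (sup_le h1 hME)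
    ((finrank_point_sup_line hP (h.finrank_eq M hM) hPM).trans h3.symm)
  exact Finset.mem_image.2 ⟨M, mem_freeLines.2 ⟨hM, hPM, by rwa [hE']⟩, hE'⟩

theorem card_freePlanes_le (h : BlocksPlanesOf B U) (hP : Module.finrank K P = 1) :
    (freePlanes B P U).card ≤ (freeLines B P).card :=
  (Finset.card_le_card (h.freePlanes_subset hP)).trans Finset.card_image_le

theorem card_planes_sdiff_freePlanes (C : Submodule K V) :
    (subspacesBetween P C 3).card ≤ (freePlanes B P C).card +
      ((linesThrough B P).biUnion fun L => subspacesBetween L C 3).card := by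
  refine (Finset.card_le_card ?_).trans (Finset.card_union_le _ _)
  intro E hE
  rw [mem_subspacesBetween] at hE
  by_cases h : ∀ L ∈ linesThrough B P, ¬ L ≤ E
  · exact Finset.mem_union_left _ (mem_freePlanes.2 ⟨hE, h⟩)
  · push Not at h
    obtain ⟨L, hL, hLE⟩ := h
    exact Finset.mem_union_right _ (Finset.mem_biUnion.2
      ⟨L, hL, mem_subspacesBetween.2 ⟨hLE, hE.2.1, hE.2.2⟩⟩)

variable [Finite K]

theorem card_planes_on_line (h : BlocksPlanesOf B U) {C L : Submodule K V} {m : ℕ}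
    (hC : Module.finrank K C = 2 + m) (hL : L ∈ B) (hLC : L ≤ C) :
    (subspacesBetween L C 3).card = ∑ i ∈ Finset.range m, Nat.card K ^ i :=
  card_subspacesBetween_succ hLC (h.finrank_eq L hL) hC

/-- Every plane on P either contains one of the lines of B on P, each of which is on q^2 + q + 1
planes, or is spanned by P and a free line. -/
theorem card_planes_le (h : BlocksPlanesOf B U) (hU : Module.finrank K U = 5)
    (hP : Module.finrank K P = 1) (hPU : P ≤ U) :
    (Nat.card K ^ 2 + 1) * (Nat.card K ^ 2 + Nat.card K + 1) ≤ (freeLines B P).card +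
      (linesThrough B P).card * (Nat.card K ^ 2 + Nat.card K + 1) := by
  rw [← card_subspacesBetween_add_two_of_four hPU hP (by omega)]
  refine (card_planes_sdiff_freePlanes (B := B) U).trans
    (add_le_add (h.card_freePlanes_le hP) (Finset.card_biUnion_le_card_mul _ _ _ ?_))
  intro L hL
  have hL := (mem_linesThrough.1 hL).1
  rw [h.card_planes_on_line (m := 3) (by omega) hL (h.le L hL)]
  simp only [Finset.sum_range_succ, Finset.sum_range_zero]
  apply le_of_eq; ring

/-- Every point is on at least `q` lines of a small blocking set. -/
theorem le_card_linesThrough (h : BlocksPlanesOf B U) (hU : Module.finrank K U = 5)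
    (hcard : B.card ≤ Nat.card K ^ 4 + 2 * Nat.card K ^ 2 + Nat.card K)
    (hP : Module.finrank K P = 1) (hPU : P ≤ U) : Nat.card K ≤ (linesThrough B P).card := by
  have h1 := h.card_planes_le hU hP hPU
  have h2 := card_linesThrough_add B P
  by_contra! hlt
  obtain ⟨k, hk⟩ := Nat.exists_eq_add_of_lt hlt
  generalize (linesThrough B P).card = d at *
  generalize (freeLines B P).card = r at *
  rw [hk] at h1 hcard
  -- With d = q - 1 - k, the lines on P and the free lines already number at least q^4 + 2q^2 + 2q +
  -- 1 + k(q^2 + q).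
  nlinarith [Nat.zero_le (k * (d + k + 1) ^ 2), Nat.zero_le (k * (d + k + 1)), Nat.zero_le k,
    Nat.zero_le d]

theorem sum_card_linesThrough (h : BlocksPlanesOf B U) :
    ∑ P ∈ subspacesBetween ⊥ U 1, (linesThrough B P).card = B.card * (Nat.card K + 1) := by
  have := Finset.sum_card_bipartiteAbove_eq_sum_card_bipartiteBelow
    (s := subspacesBetween ⊥ U 1) (t := B) (fun P L => P ≤ L)
  refine this.trans (Finset.sum_const_nat fun L hL => ?_)
  have h1 : Finset.bipartiteBelow (fun P L => P ≤ L) (subspacesBetween ⊥ U 1) L =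
      subspacesBetween ⊥ L 1 := by
    ext P
    simp only [Finset.mem_bipartiteBelow, mem_subspacesBetween]
    exact ⟨fun h => ⟨bot_le, h.2, h.1.2.2⟩, fun h' => ⟨⟨bot_le, h'.2.1.trans (h.le L hL), h'.2.2⟩,
      h'.2.1⟩⟩
  rw [h1, card_subspacesBetween_succ bot_le (finrank_bot K V) (m := 2)
    (by rw [h.finrank_eq L hL])]
  simp [Finset.sum_range_succ, add_comm]

/-- If all degrees exceeded q, counting incident point-line pairs would make B at least as large as
the point set of the 4-space, which is too many since q^3 ≥ 2q^2. -/
theorem exists_card_linesThrough_eq (h : BlocksPlanesOf B U) (hU : Module.finrank K U = 5)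
    (hcard : B.card ≤ Nat.card K ^ 4 + 2 * Nat.card K ^ 2 + Nat.card K) :
    ∃ P ≤ U, Module.finrank K P = 1 ∧ (linesThrough B P).card = Nat.card K := by
  have hq : 2 ≤ Nat.card K := Finite.one_lt_card
  by_contra! hne
  have h1 : ∀ P ∈ subspacesBetween ⊥ U 1, Nat.card K + 1 ≤ (linesThrough B P).card := by
    intro P hP
    obtain ⟨-, h2, h3⟩ := mem_subspacesBetween.1 hP
    have := h.le_card_linesThrough hU hcard h3 h2
    have := hne P h2 h3
    omega
  have h2 := Finset.card_nsmul_le_sum _ _ _ h1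
  rw [h.sum_card_linesThrough, smul_eq_mul,
    card_subspacesBetween_succ bot_le (finrank_bot K V) (m := 5) (by omega)] at h2
  have h3 := Nat.le_of_mul_le_mul_right h2 (Nat.succ_pos _)
  simp only [Finset.sum_range_succ, Finset.sum_range_zero] at h3
  nlinarith [Nat.mul_le_mul_right (Nat.card K ^ 2) hq]

end BlocksPlanesOf

end Blocking

/-! ### The extremal configuration at a point of degree q, and its contradiction. -/

section Core

open scoped Classical

variable {K V : Type*} [Field K] [AddCommGroup V] [Module K V] [Finite V] [Finite K]

namespace BlocksPlanesOf

variable {B : Finset (Submodule K V)} {U P E H : Submodule K V}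

/-- If every point is on at least `q` lines of `B`, then every line `L` of `B` on `P` lies in the
plane spanned by `P` and `M` for at least `q (q - 1)` lines `M` of `B` off `P`. -/
theorem le_card_filter_boundLines (h : BlocksPlanesOf B U)
    (hd : ∀ Q ≤ U, Module.finrank K Q = 1 → Nat.card K ≤ (linesThrough B Q).card)
    (hP : Module.finrank K P = 1) {L : Submodule K V} (hL : L ∈ linesThrough B P) :
    Nat.card K * (Nat.card K - 1) ≤ ((boundLines B P).filter fun M => L ≤ P ⊔ M).card := by
  obtain ⟨hLB, hPL⟩ := mem_linesThrough.1 hL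
  have hL2 := h.finrank_eq L hLB
  have hQ : ∀ Q ∈ (subspacesBetween ⊥ L 1).erase P,
      Q ≠ P ∧ Q ≤ L ∧ Module.finrank K Q = 1 := by
    intro Q hQ
    rw [Finset.mem_erase, mem_subspacesBetween] at hQ
    exact ⟨hQ.1, hQ.2.2.1, hQ.2.2.2⟩
  have hcardQ : ((subspacesBetween ⊥ L 1).erase P).card = Nat.card K := by
    rw [Finset.card_erase_of_mem (by simp [hPL, hP]),
      card_subspacesBetween_succ bot_le (finrank_bot K V) (m := 2) (by omega)]
    simp [Finset.sum_range_succ]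
  -- A line M ≠ L of B on a point Q ≠ P of L misses P, and L = P ⊔ Q lies in P ⊔ M. Such an M meets
  -- L only in Q, so different Q give different M.
  have hsub : (((subspacesBetween ⊥ L 1).erase P).biUnion fun Q => (linesThrough B Q).erase L) ⊆
      (boundLines B P).filter fun M => L ≤ P ⊔ M := by
    intro M hM
    obtain ⟨Q, hQ', hM⟩ := Finset.mem_biUnion.1 hM
    obtain ⟨hQP, hQL, hQ1⟩ := hQ Q hQ'
    rw [Finset.mem_erase, mem_linesThrough] at hM
    obtain ⟨hML, hMB, hQM⟩ := hM
    have hLPM : L ≤ P ⊔ M := by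
      rw [← sup_points_eq hP hQ1 hL2 hQP.symm hPL hQL]
      exact sup_le_sup_left hQM P
    refine Finset.mem_filter.2 ⟨mem_boundLines.2 ⟨hMB, fun hPM => hQP ?_, L, hL, hLPM⟩, hLPM⟩
    rw [← inf_lines_eq hP hL2 (h.finrank_eq M hMB) hML.symm hPL hPM,
      inf_lines_eq hQ1 hL2 (h.finrank_eq M hMB) hML.symm hQL hQM]
  refine le_trans ?_ (Finset.card_le_card hsub)
  rw [Finset.card_biUnion, ← hcardQ, ← smul_eq_mul]
  · refine Finset.card_nsmul_le_sum _ _ _ fun Q hQ' => ?_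
    obtain ⟨hQP, hQL, hQ1⟩ := hQ Q hQ'
    rw [hcardQ, Finset.card_erase_of_mem (by simp [hLB, hQL])]
    exact Nat.sub_le_sub_right (hd Q (hQL.trans (h.le L hLB)) hQ1) 1
  · intro Q hQ' R hR' hQR
    obtain ⟨-, hQL, hQ1⟩ := hQ Q hQ'
    obtain ⟨-, hRL, hR1⟩ := hQ R hR'
    refine Finset.disjoint_left.2 fun M hM hM' => hQR ?_
    rw [Finset.mem_erase, mem_linesThrough] at hM hM'
    rw [← inf_lines_eq hQ1 hL2 (h.finrank_eq M hM.2.1) hM.1.symm hQL hM.2.2,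
      inf_lines_eq hR1 hL2 (h.finrank_eq M hM.2.1) hM.1.symm hRL hM'.2.2]

theorem le_sum_card_filter_linesThrough (h : BlocksPlanesOf B U)
    (hd : ∀ Q ≤ U, Module.finrank K Q = 1 → Nat.card K ≤ (linesThrough B Q).card)
    (hP : Module.finrank K P = 1) (hdP : (linesThrough B P).card = Nat.card K) :
    Nat.card K * (Nat.card K * (Nat.card K - 1)) ≤
      ∑ M ∈ boundLines B P, ((linesThrough B P).filter fun L => L ≤ P ⊔ M).card := by
  have h1 := Finset.card_nsmul_le_sum (linesThrough B P) _ _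
    fun L hL => h.le_card_filter_boundLines hd hP hL
  rw [hdP, smul_eq_mul] at h1
  exact h1.trans (Finset.sum_card_bipartiteAbove_eq_sum_card_bipartiteBelow
    (s := linesThrough B P) (t := boundLines B P) (fun L M => L ≤ P ⊔ M)).le

/-- If a small blocking set has exactly `q` lines on `P`, then these are coplanar. -/
theorem exists_plane (h : BlocksPlanesOf B U) (hU : Module.finrank K U = 5)
    (hcard : B.card ≤ Nat.card K ^ 4 + 2 * Nat.card K ^ 2 + Nat.card K)
    (hP : Module.finrank K P = 1) (hPU : P ≤ U) (hdP : (linesThrough B P).card = Nat.card K) :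
    ∃ E ≤ U, Module.finrank K E = 3 ∧ P ≤ E ∧ ∀ L ∈ linesThrough B P, L ≤ E := by
  have hq : 2 ≤ Nat.card K := Finite.one_lt_card
  by_cases hex : ∃ M ∈ boundLines B P, ∀ L ∈ linesThrough B P, L ≤ P ⊔ M
  · obtain ⟨M, hM, hM'⟩ := hex
    obtain ⟨hMB, hPM, -⟩ := mem_boundLines.1 hM
    exact ⟨P ⊔ M, sup_le hPU (h.le M hMB), finrank_point_sup_line hP (h.finrank_eq M hMB) hPM,
      le_sup_left, hM'⟩
  exfalso
  push Not at hex
  have h1 := h.le_sum_card_filter_linesThrough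
    (fun Q hQU hQ => h.le_card_linesThrough hU hcard hQ hQU) hP hdP
  -- If no plane P ⊔ M contains all q lines on P, each bound line is counted at most q - 1 times, so
  -- there are at least q^2 bound lines.
  have h2 := Finset.sum_le_card_nsmul (boundLines B P)
    (fun M => ((linesThrough B P).filter fun L => L ≤ P ⊔ M).card) (Nat.card K - 1) (by
      intro M hM
      obtain ⟨L, hL, hLM⟩ := hex M hM
      refine Nat.le_sub_one_of_lt ?_
      rw [← hdP]
      exact Finset.card_lt_card (Finset.filter_ssubset.2 ⟨L, hL, hLM⟩))
  have h3 := h1.trans h2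
  rw [smul_eq_mul, ← mul_assoc] at h3
  have h4 := Nat.le_of_mul_le_mul_right h3 (by omega)
  have h5 := h.card_planes_le hU hP hPU
  have h6 := card_linesThrough_add B P
  rw [hdP] at h5 h6
  -- The three classes add up to at least q + q^2 + (q^2 - q + 1)(q^2 + q + 1) = q^4 + 2q^2 + q + 1.
  nlinarith

/-- The q lines on P share the plane E, so they cover at most 1 + q(q^2 + q) planes; counting E only
once improves the estimate of `card_planes_le`. -/
theorem le_card_freePlanes (h : BlocksPlanesOf B U) (hU : Module.finrank K U = 5)
    (hP : Module.finrank K P = 1) (hPU : P ≤ U) (hdP : (linesThrough B P).card = Nat.card K)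
    (hEU : E ≤ U) (hE : Module.finrank K E = 3) (hBE : ∀ L ∈ linesThrough B P, L ≤ E) :
    Nat.card K ^ 4 + Nat.card K ^ 2 + Nat.card K ≤ (freePlanes B P U).card := by
  have h1 := card_planes_sdiff_freePlanes (B := B) (P := P) U
  rw [card_subspacesBetween_add_two_of_four hPU hP (by omega)] at h1
  have h2 : ((linesThrough B P).biUnion fun L => subspacesBetween L U 3) ⊆
      insert E ((linesThrough B P).biUnion fun L => (subspacesBetween L U 3).erase E) := by
    intro F hF
    obtain ⟨L, hL, hF⟩ := Finset.mem_biUnion.1 hF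
    by_cases hFE : F = E
    · exact hFE ▸ Finset.mem_insert_self _ _
    · exact Finset.mem_insert_of_mem (Finset.mem_biUnion.2 ⟨L, hL, Finset.mem_erase.2 ⟨hFE, hF⟩⟩)
  have h3 := (Finset.card_le_card h2).trans (Finset.card_insert_le _ _)
  have h4 := Finset.card_biUnion_le_card_mul (linesThrough B P)
    (fun L => (subspacesBetween L U 3).erase E) (Nat.card K ^ 2 + Nat.card K) (by
      intro L hL
      have hLB := (mem_linesThrough.1 hL).1
      rw [Finset.card_erase_of_mem (by simp [hBE L hL, hEU, hE]),
        h.card_planes_on_line (m := 3) (by omega) hLB (h.le L hLB)]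
      simp only [Finset.sum_range_succ, Finset.sum_range_zero]
      exact (Nat.sub_eq_of_eq_add (by ring)).le)
  rw [hdP] at h4
  nlinarith

/-- The lines of `B` around a point `P` on exactly `q` lines of a small blocking set `B`. -/
theorem boundLines_structure (h : BlocksPlanesOf B U) (hU : Module.finrank K U = 5)
    (hcard : B.card ≤ Nat.card K ^ 4 + 2 * Nat.card K ^ 2 + Nat.card K)
    (hP : Module.finrank K P = 1) (hPU : P ≤ U) (hdP : (linesThrough B P).card = Nat.card K)
    (hEU : E ≤ U) (hE : Module.finrank K E = 3)
    (hBE : ∀ L ∈ linesThrough B P, L ≤ E) :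
    (boundLines B P).card = Nat.card K * (Nat.card K - 1) ∧
      (freeLines B P).card ≤ (freePlanes B P U).card ∧ ∀ M ∈ boundLines B P, M ≤ E := by
  have hq : 2 ≤ Nat.card K := Finite.one_lt_card
  have h1 := h.le_sum_card_filter_linesThrough
    (fun Q hQU hQ => h.le_card_linesThrough hU hcard hQ hQU) hP hdP
  have h2 : ∀ M ∈ boundLines B P,
      ((linesThrough B P).filter fun L => L ≤ P ⊔ M).card ≤ Nat.card K := fun M _ =>
    hdP ▸ Finset.card_filter_le _ _
  have h3 := Finset.sum_le_card_nsmul _ _ _ h2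
  have h4 := h.le_card_freePlanes hU hP hPU hdP hEU hE hBE
  have h5 := h.card_freePlanes_le hP
  have h6 := card_linesThrough_add B P
  have h7 : (boundLines B P).card = Nat.card K * (Nat.card K - 1) := by
    refine le_antisymm ?_ ?_
    · obtain ⟨k, hk⟩ := Nat.exists_eq_add_of_le' hq
      rw [Nat.mul_sub, mul_one, ← pow_two]
      omega
    · have := h1.trans h3
      rw [smul_eq_mul, mul_comm _ (Nat.card K)] at this
      exact Nat.le_of_mul_le_mul_left this (by omega)
  have h8 : Nat.card K * (Nat.card K - 1) + Nat.card K = Nat.card K ^ 2 := by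
    rw [← Nat.mul_succ, pow_two]
    congr 1; omega
  refine ⟨h7, by omega, fun M hM => ?_⟩
  -- The double count is now an equality, so every bound line attains the maximum q. As q ≥ 2, its
  -- plane P ⊔ M shares two lines with E and hence equals E.
  have h9 : ((linesThrough B P).filter fun L => L ≤ P ⊔ M).card = Nat.card K := by
    refine (h2 M hM).antisymm (not_lt.1 fun hlt => ?_)
    have := (Finset.sum_lt_sum h2 ⟨M, hM, hlt⟩).trans_le' h1
    rw [Finset.sum_const, smul_eq_mul, h7, mul_comm] at this
    exact lt_irrefl _ this
  have h10 : ∀ L ∈ linesThrough B P, L ≤ P ⊔ M :=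
    Finset.card_filter_eq_iff.1 (h9.trans hdP.symm)
  obtain ⟨hMB, hPM, -⟩ := mem_boundLines.1 hM
  obtain ⟨L, hL, L', hL', hne⟩ := Finset.one_lt_card.1 (hdP.symm ▸ hq : 1 < (linesThrough B P).card)
  obtain ⟨hLB, hPL⟩ := mem_linesThrough.1 hL
  obtain ⟨hLB', hPL'⟩ := mem_linesThrough.1 hL'
  have hs := fun F => sup_lines_eq (E := F) hP (h.finrank_eq L hLB) (h.finrank_eq L' hLB') hne
    hPL hPL'
  rw [← hs E hE (hBE L hL) (hBE L' hL'), hs (P ⊔ M)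
    (finrank_point_sup_line hP (h.finrank_eq M hMB) hPM) (h10 L hL) (h10 L' hL')]
  exact le_sup_right

/-- In a solid `H` on the plane `E` of the lines of `B` on `P`, at most `q` planes on `P` contain
no line of `B` on `P`. -/
theorem card_freePlanes_solid (h : BlocksPlanesOf B U) (hP : Module.finrank K P = 1)
    (hdP : (linesThrough B P).card = Nat.card K) (hE : Module.finrank K E = 3) (hPE : P ≤ E)
    (hBE : ∀ L ∈ linesThrough B P, L ≤ E) (hEH : E ≤ H) (hH : Module.finrank K H = 4) :
    (freePlanes B P H).card ≤ Nat.card K := by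
  have hq : 2 ≤ Nat.card K := Finite.one_lt_card
  have hdisj : Disjoint (freePlanes B P H) (insert E
      ((linesThrough B P).biUnion fun L => (subspacesBetween L H 3).erase E)) := by
    obtain ⟨L, hL⟩ := Finset.card_pos.1 (by omega : 0 < (linesThrough B P).card)
    refine Finset.disjoint_left.2 fun F hF hF' => ?_
    have hF := (mem_freePlanes.1 hF).2
    rcases Finset.mem_insert.1 hF' with rfl | hF'
    · exact hF L hL (hBE L hL)
    · obtain ⟨L, hL, hF'⟩ := Finset.mem_biUnion.1 hF'
      exact hF L hL (mem_subspacesBetween.1 (Finset.mem_of_mem_erase hF')).1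
  have hsub : freePlanes B P H ∪ (insert E
      ((linesThrough B P).biUnion fun L => (subspacesBetween L H 3).erase E)) ⊆
      subspacesBetween P H 3 := by
    refine Finset.union_subset (Finset.filter_subset _ _) (Finset.insert_subset
      (by simp [hPE, hEH, hE]) (Finset.biUnion_subset.2 fun L hL F hF => ?_))
    have hF := mem_subspacesBetween.1 (Finset.mem_of_mem_erase hF)
    exact mem_subspacesBetween.2 ⟨(mem_linesThrough.1 hL).2.trans hF.1, hF.2⟩
  have hc := Finset.card_le_card hsub
  rw [Finset.card_union_of_disjoint hdisj, card_subspacesBetween_add_two_of_three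
    (hPE.trans hEH) hP (by omega), Finset.card_insert_of_notMem, Finset.card_biUnion,
    Finset.sum_const_nat (m := Nat.card K), hdP] at hc
  · nlinarith
  · intro L hL
    have hLB := (mem_linesThrough.1 hL).1
    rw [Finset.card_erase_of_mem (by simp [hBE L hL, hEH, hE]),
      h.card_planes_on_line (m := 2) (by omega) hLB ((hBE L hL).trans hEH)]
    simp [Finset.sum_range_succ]
  · intro L hL L' hL' hne
    obtain ⟨hLB, hPL⟩ := mem_linesThrough.1 hL
    obtain ⟨hLB', hPL'⟩ := mem_linesThrough.1 hL'
    refine Finset.disjoint_left.2 fun F hF hF' => Finset.ne_of_mem_erase hF ?_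
    have hF := mem_subspacesBetween.1 (Finset.mem_of_mem_erase hF)
    have hF' := mem_subspacesBetween.1 (Finset.mem_of_mem_erase hF')
    have hs := fun F => sup_lines_eq (E := F) hP (h.finrank_eq L hLB) (h.finrank_eq L' hLB') hne
      hPL hPL'
    rw [← hs E hE (hBE L hL) (hBE L' hL'), hs F hF.2.2 hF.1 hF'.1]
  · simp

/-- Counting the incident pairs of a line of `B` and a plane in a solid. -/
theorem sum_card_lines_in_planes (h : BlocksPlanesOf B U) (hH : Module.finrank K H = 4) :
    ∑ F ∈ subspacesBetween ⊥ H 3, (B.filter (· ≤ F)).card =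
      (B.filter (· ≤ H)).card * (Nat.card K + 1) := by
  have h1 : ∀ F ∈ subspacesBetween ⊥ H 3, (B.filter (· ≤ F)).card =
      (Finset.bipartiteAbove (fun F L => L ≤ F) (B.filter (· ≤ H)) F).card := by
    intro F hF
    congr 1
    ext L
    simp only [Finset.mem_filter, Finset.mem_bipartiteAbove, mem_subspacesBetween] at hF ⊢
    exact ⟨fun h => ⟨⟨h.1, h.2.trans hF.2.1⟩, h.2⟩, fun h => ⟨h.1.1, h.2⟩⟩
  rw [Finset.sum_congr rfl h1, Finset.sum_card_bipartiteAbove_eq_sum_card_bipartiteBelow]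
  refine Finset.sum_const_nat fun L hL => ?_
  rw [Finset.mem_filter] at hL
  have h2 : Finset.bipartiteBelow (fun F L => L ≤ F) (subspacesBetween ⊥ H 3) L =
      subspacesBetween L H 3 := by
    ext F
    simp only [Finset.mem_bipartiteBelow, mem_subspacesBetween]
    exact ⟨fun h => ⟨h.2, h.1.2⟩, fun h => ⟨⟨bot_le, h.2⟩, h.1⟩⟩
  rw [h2, h.card_planes_on_line (m := 2) (by omega) hL.1 hL.2]
  simp [Finset.sum_range_succ, add_comm]

/-- A plane on `q ^ 2` lines of a blocking set does not lie in a solid with at most `q ^ 2 + q`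
such lines. -/
theorem lt_card_lines_in_solid (h : BlocksPlanesOf B U) (hHU : H ≤ U)
    (hH : Module.finrank K H = 4) (hEH : E ≤ H) (hE : Module.finrank K E = 3)
    (hBE : (B.filter (· ≤ E)).card = Nat.card K ^ 2) :
    Nat.card K ^ 2 + Nat.card K < (B.filter (· ≤ H)).card := by
  have hq : 2 ≤ Nat.card K := Finite.one_lt_card
  by_contra! hBH
  have hpos : ∀ F ∈ subspacesBetween ⊥ H 3, 1 ≤ (B.filter (· ≤ F)).card := by
    intro F hF
    obtain ⟨-, h1, h2⟩ := mem_subspacesBetween.1 hF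
    obtain ⟨L, hL, hLF⟩ := h.exists_le F (h1.trans hHU) h2
    exact Finset.card_pos.2 ⟨L, by simp [hL, hLF]⟩
  have hEmem : E ∈ subspacesBetween ⊥ H 3 := by simp [hEH, hE]
  have hsum := h.sum_card_lines_in_planes hH
  rw [← Finset.add_sum_erase _ _ hEmem, hBE] at hsum
  have hcard : ((subspacesBetween ⊥ H 3).erase E).card =
      Nat.card K ^ 3 + Nat.card K ^ 2 + Nat.card K := by
    rw [Finset.card_erase_of_mem hEmem, card_subspacesBetween_bot_three hH]
    exact Nat.sub_eq_of_eq_add (by ring)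
  have hge : ((subspacesBetween ⊥ H 3).erase E).card ≤
      ∑ F ∈ (subspacesBetween ⊥ H 3).erase E, (B.filter (· ≤ F)).card := by
    simpa using Finset.card_nsmul_le_sum _ _ _
      fun F hF => hpos F (Finset.mem_of_mem_erase hF)
  -- The count is tight: E contributes q^2, the other q^3 + q^2 + q planes at least 1 each, and the
  -- total is at most (q^2 + q)(q + 1).
  have hBH' : (B.filter (· ≤ H)).card = Nat.card K ^ 2 + Nat.card K := by
    refine hBH.antisymm (Nat.le_of_mul_le_mul_right (c := Nat.card K + 1) ?_ (Nat.succ_pos _))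
    rw [← hsum]
    nlinarith
  have hone : ∀ F ≤ H, Module.finrank K F = 3 → F ≠ E → ∀ L ∈ B, ∀ M ∈ B, L ≤ F → M ≤ F →
      L = M := by
    intro F hFH hF hFE L hL M hM hLF hMF
    have hFmem : F ∈ (subspacesBetween ⊥ H 3).erase E := by simp [hFE, hFH, hF]
    by_contra hLM
    have h1 : 1 < (B.filter (· ≤ F)).card :=
      Finset.one_lt_card.2 ⟨L, by simp [hL, hLF], M, by simp [hM, hMF], hLM⟩
    have h2 := Finset.sum_lt_sum (f := fun _ => 1)
      (fun F hF => hpos F (Finset.mem_of_mem_erase hF)) ⟨F, hFmem, h1⟩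
    rw [Finset.sum_const, smul_eq_mul, mul_one, hcard] at h2
    rw [hBH'] at hsum
    nlinarith
  have hout : 1 < ((B.filter (· ≤ H)) \ (B.filter (· ≤ E))).card := by
    rw [Finset.card_sdiff_of_subset
      (Finset.monotone_filter_right B fun L _ hL => le_trans hL hEH), hBE, hBH']
    omega
  have hpt : ∀ L ≤ H, Module.finrank K L = 2 → ¬ L ≤ E → Module.finrank K ↥(L ⊓ E) = 1 := by
    intro L hLH hL hLE
    have h1 := Submodule.finrank_sup_add_finrank_inf_eq L E
    have h2 := Submodule.finrank_mono (sup_le hLH hEH)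
    have h3 := Submodule.finrank_lt_finrank_of_lt (inf_lt_left.2 hLE)
    omega
  -- Otherwise L and M would span a plane other than E containing two lines of B.
  have hoff : ∀ L ∈ B, L ≤ H → ¬ L ≤ E → ∀ M ∈ B, L ⊓ E ≤ M → ¬ M ≤ E := by
    intro L hL hLH hLE M hM hLM hME
    have hL2 := h.finrank_eq L hL
    have hne : L ≠ M := fun hLM => hLE (hLM ▸ hME)
    have h3 := finrank_sup_lines (hpt L hLH hL2 hLE) hL2 (h.finrank_eq M hM) hne inf_le_left hLM
    exact hne (hone (L ⊔ M) (sup_le hLH (hME.trans hEH)) h3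
      (fun hs => hLE (hs ▸ le_sup_left)) L hL M hM le_sup_left le_sup_right)
  obtain ⟨L, hL, M, hM, hLM⟩ := Finset.one_lt_card.1 hout
  simp only [Finset.mem_sdiff, Finset.mem_filter, not_and] at hL hM
  obtain ⟨⟨hLB, hLH⟩, hLE⟩ := hL
  obtain ⟨⟨hMB, hMH⟩, hME⟩ := hM
  replace hLE := hLE hLB
  replace hME := hME hMB
  have hL2 := h.finrank_eq L hLB
  have hM2 := h.finrank_eq M hMB
  have hLp := hpt L hLH hL2 hLE
  have hMp := hpt M hMH hM2 hME
  have hne : L ⊓ E ≠ M ⊓ E := by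
    intro heq
    have h3 := finrank_sup_lines hLp hL2 hM2 hLM inf_le_left (heq ▸ inf_le_left)
    exact hLM (hone (L ⊔ M) (sup_le hLH hMH) h3 (fun hs => hLE (hs ▸ le_sup_left)) L hLB M hMB
      le_sup_left le_sup_right)
  have hpencil : ∀ L ≤ H, Module.finrank K L = 2 → ¬ L ≤ E →
      (subspacesBetween (L ⊓ E) E 2).card = Nat.card K + 1 := by
    intro L hLH hL hLE
    rw [card_subspacesBetween_succ inf_le_right (hpt L hLH hL hLE) (m := 2) (by omega)]
    simp [Finset.sum_range_succ, add_comm]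
  have hinter : (subspacesBetween (L ⊓ E) E 2 ∩ subspacesBetween (M ⊓ E) E 2).card ≤ 1 := by
    refine Finset.card_le_one.2 fun X hX Y hY => ?_
    simp only [Finset.mem_inter, mem_subspacesBetween] at hX hY
    rw [← sup_points_eq hLp hMp hX.1.2.2 hne hX.1.1 hX.2.1,
      ← sup_points_eq hLp hMp hY.1.2.2 hne hY.1.1 hY.2.1]
  have hunion := Finset.card_union_add_card_inter (subspacesBetween (L ⊓ E) E 2)
    (subspacesBetween (M ⊓ E) E 2)
  rw [hpencil L hLH hL2 hLE, hpencil M hMH hM2 hME] at hunion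
  have hdisj : Disjoint (B.filter (· ≤ E))
      (subspacesBetween (L ⊓ E) E 2 ∪ subspacesBetween (M ⊓ E) E 2) := by
    refine Finset.disjoint_left.2 fun X hX hX' => ?_
    rw [Finset.mem_filter] at hX
    rw [Finset.mem_union, mem_subspacesBetween, mem_subspacesBetween] at hX'
    rcases hX' with hX' | hX'
    · exact hoff L hLB hLH hLE X hX.1 hX'.1 hX.2
    · exact hoff M hMB hMH hME X hX.1 hX'.1 hX.2
  have hsub : (B.filter (· ≤ E)) ∪
      (subspacesBetween (L ⊓ E) E 2 ∪ subspacesBetween (M ⊓ E) E 2) ⊆ subspacesBetween ⊥ E 2 := by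
    intro X hX
    simp only [Finset.mem_union, Finset.mem_filter, mem_subspacesBetween] at hX ⊢
    rcases hX with hX | hX | hX
    · exact ⟨bot_le, hX.2, h.finrank_eq X hX.1⟩
    · exact ⟨bot_le, hX.2⟩
    · exact ⟨bot_le, hX.2⟩
  -- The pencils of E at the two points L ⊓ E and M ⊓ E cover at least 2q + 1 lines, none in B; with
  -- the q^2 lines of B this exceeds the q^2 + q + 1 lines of E.
  have hfin := Finset.card_le_card hsub
  rw [Finset.card_union_of_disjoint hdisj, hBE,
    card_subspacesBetween_add_two_of_three bot_le (finrank_bot K V) (by omega)] at hfin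
  omega

/-- The bound of Eisfeld and Metsch for lines blocking the planes of a projective 4-space. -/
theorem le_card (h : BlocksPlanesOf B U) (hU : Module.finrank K U = 5) :
    Nat.card K ^ 4 + 2 * Nat.card K ^ 2 + Nat.card K + 1 ≤ B.card := by
  have hq : 2 ≤ Nat.card K := Finite.one_lt_card
  by_contra! hlt
  have hcard := Nat.le_of_lt_succ hlt
  obtain ⟨P, hPU, hP, hdP⟩ := h.exists_card_linesThrough_eq hU hcard
  obtain ⟨E, hEU, hE, hPE, hBE⟩ := h.exists_plane hU hcard hP hPU hdP
  obtain ⟨hS, hR, hSE⟩ := h.boundLines_structure hU hcard hP hPU hdP hEU hE hBE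
  have hq2 : Nat.card K + Nat.card K * (Nat.card K - 1) = Nat.card K ^ 2 := by
    rw [add_comm, ← Nat.mul_succ, pow_two]
    congr 1; omega
  obtain ⟨H, hH⟩ := Finset.card_pos.1 (by
    rw [card_subspacesBetween_succ hEU hE (m := 2) (by omega)]
    simp [Finset.sum_range_succ] : 0 < (subspacesBetween E U (3 + 1)).card)
  obtain ⟨hEH, hHU, hH⟩ := mem_subspacesBetween.1 hH
  have hdisj : Disjoint (linesThrough B P) (boundLines B P) :=
    Finset.disjoint_left.2 fun L hL hL' => (mem_boundLines.1 hL').2.1 (mem_linesThrough.1 hL).2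
  have hE' : B.filter (· ≤ E) = linesThrough B P ∪ boundLines B P := by
    ext M
    rw [Finset.mem_filter, Finset.mem_union]
    constructor
    · rintro ⟨hM, hME⟩
      by_cases hPM : P ≤ M
      · exact Or.inl (mem_linesThrough.2 ⟨hM, hPM⟩)
      · obtain ⟨L, hL⟩ := Finset.card_pos.1 (by omega : 0 < (linesThrough B P).card)
        refine Or.inr (mem_boundLines.2 ⟨hM, hPM, L, hL, ?_⟩)
        rw [Submodule.eq_of_le_of_finrank_eq (sup_le hPE hME)
          ((finrank_point_sup_line hP (h.finrank_eq M hM) hPM).trans hE.symm)]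
        exact hBE L hL
    · rintro (hM | hM)
      · exact ⟨(mem_linesThrough.1 hM).1, hBE M hM⟩
      · exact ⟨(mem_boundLines.1 hM).1, hSE M hM⟩
  have hcardE : (B.filter (· ≤ E)).card = Nat.card K ^ 2 := by
    rw [hE', Finset.card_union_of_disjoint hdisj, hdP, hS, hq2]
  have hlt := h.lt_card_lines_in_solid hHU hH hEH hE hcardE
  refine hlt.not_ge ?_
  -- There are no more free lines than free planes, so the surjection between them is injective, and
  -- the free lines in H are bounded by the free planes in H.
  have hinj : Set.InjOn (P ⊔ ·) (freeLines B P : Set (Submodule K V)) :=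
    Finset.card_image_iff.1 (Finset.card_image_le.antisymm
      (hR.trans (Finset.card_le_card (h.freePlanes_subset hP))))
  have hfree : ((freeLines B P).filter (· ≤ H)).card ≤ Nat.card K := by
    refine le_trans (Finset.card_le_card_of_injOn (P ⊔ ·) (fun M hM => ?_)
      (hinj.mono (Finset.coe_subset.2 (Finset.filter_subset _ _))))
      (h.card_freePlanes_solid hP hdP hE hPE hBE hEH hH)
    rw [Finset.coe_filter, Set.mem_ofPred_eq, mem_freeLines] at hM
    obtain ⟨⟨hMB, hPM, hM'⟩, hMH⟩ := hM
    exact mem_freePlanes.2 ⟨⟨le_sup_left, sup_le (hPE.trans hEH) hMH,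
      finrank_point_sup_line hP (h.finrank_eq M hMB) hPM⟩, hM'⟩
  have hsub : B.filter (· ≤ H) ⊆ B.filter (· ≤ E) ∪ (freeLines B P).filter (· ≤ H) := by
    intro M hM
    rw [Finset.mem_filter] at hM
    rw [hE', Finset.mem_union, Finset.mem_union, Finset.mem_filter]
    by_cases hPM : P ≤ M
    · exact Or.inl (Or.inl (mem_linesThrough.2 ⟨hM.1, hPM⟩))
    · by_cases hL : ∃ L ∈ linesThrough B P, L ≤ P ⊔ M
      · exact Or.inl (Or.inr (mem_boundLines.2 ⟨hM.1, hPM, hL⟩))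
      · push Not at hL
        exact Or.inr ⟨mem_freeLines.2 ⟨hM.1, hPM, hL⟩, hM.2⟩
  have := (Finset.card_le_card hsub).trans (Finset.card_union_le _ _)
  omega

end BlocksPlanesOf

end Core

/-! ### From 4-spaces to n-spaces. -/

section Averaging

open scoped Classical

variable {K V : Type*} [Field K] [AddCommGroup V] [Module K V] [Finite V] [Finite K]

theorem card_subspacesBetween_add_three {A C : Submodule K V} (hAC : A ≤ C) {a m : ℕ}
    (ha : Module.finrank K A = a) (hc : Module.finrank K C = a + (m + 2)) :
    (subspacesBetween A C (a + 3)).card * ((Nat.card K + 1) * (Nat.card K ^ 2 + Nat.card K + 1)) =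
      (∑ i ∈ Finset.range (m + 2), Nat.card K ^ i) *
        ((∑ i ∈ Finset.range (m + 1), Nat.card K ^ i) * ∑ i ∈ Finset.range m, Nat.card K ^ i) := by
  have h := card_subspacesBetween_mul (A := A) (C := C) (d := a + 1) (e := a + 3)
    -- The division is exact by `card_subspacesBetween_add_two`.
    (r := ((∑ i ∈ Finset.range (m + 1), Nat.card K ^ i) * ∑ i ∈ Finset.range m, Nat.card K ^ i) /
      (Nat.card K + 1)) (s := Nat.card K ^ 2 + Nat.card K + 1) (fun X hX => by
        obtain ⟨-, h2, h3⟩ := mem_subspacesBetween.1 hX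
        rw [← card_subspacesBetween_add_two h2 h3 (m := m) (by omega),
          Nat.mul_div_cancel _ (Nat.succ_pos _)]) (fun Y hY => by
        obtain ⟨h1, -, h3⟩ := mem_subspacesBetween.1 hY
        rw [card_subspacesBetween_succ h1 ha h3]
        simp only [Finset.sum_range_succ, Finset.sum_range_zero]
        ring)
  have hpos : 0 < (subspacesBetween A C (a + 1)).card := by
    rw [card_subspacesBetween_succ hAC ha hc, Finset.sum_range_succ']
    simp
  obtain ⟨X, hX⟩ := Finset.card_pos.1 hpos
  obtain ⟨-, h2, h3⟩ := mem_subspacesBetween.1 hX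
  rw [card_subspacesBetween_succ hAC ha hc,
    ← card_subspacesBetween_add_two h2 h3 (m := m) (by omega),
    Nat.mul_div_cancel _ (Nat.succ_pos _)] at h
  rw [← card_subspacesBetween_add_two h2 h3 (m := m) (by omega), mul_comm (Nat.card K + 1),
    ← mul_assoc, ← h, mul_assoc]

/-- Averaging the bound for projective 4-spaces over all projective 4-spaces of a projective
`n`-space. -/
theorem BlocksPlanesOf.mul_le_card_mul {B : Finset (Submodule K V)} (h : BlocksPlanesOf B ⊤)
    {n : ℕ} (hn : 4 ≤ n) (hV : Module.finrank K V = n + 1) :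
    (∑ i ∈ Finset.range (n + 1), Nat.card K ^ i) * (∑ i ∈ Finset.range n, Nat.card K ^ i) *
        (Nat.card K ^ 4 + 2 * Nat.card K ^ 2 + Nat.card K + 1) ≤
      B.card * ((∑ i ∈ Finset.range 5, Nat.card K ^ i) * ∑ i ∈ Finset.range 4, Nat.card K ^ i) := by
  obtain ⟨m, rfl⟩ := Nat.exists_eq_add_of_le' hn
  have htop : Module.finrank K (⊤ : Submodule K V) = 0 + (m + 4 + 1) := by
    rw [finrank_top, hV, zero_add]
  have hlines := card_subspacesBetween_add_two (bot_le (a := (⊤ : Submodule K V)))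
    (finrank_bot K V) htop
  -- The number c of 4-spaces on a line cancels at the end, so only its constancy and positivity
  -- matter.
  obtain ⟨c, hc, hc0⟩ : ∃ c, (∀ L : Submodule K V, Module.finrank K L = 2 →
      (subspacesBetween L ⊤ 5).card = c) ∧ 0 < c := by
    have hL := fun (L : Submodule K V) (hL : Module.finrank K L = 2) =>
      card_subspacesBetween_add_three (le_top (a := L)) (m := m + 1) hL (by omega)
    have hpos : 0 < (Nat.card K + 1) * (Nat.card K ^ 2 + Nat.card K + 1) := by positivity
    refine ⟨_, fun L h2 => (Nat.div_eq_of_eq_mul_left hpos (hL L h2).symm).symm, ?_⟩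
    have hpos' : 0 < (subspacesBetween ⊥ (⊤ : Submodule K V) (0 + 2)).card * (Nat.card K + 1) := by
      rw [hlines]
      simp [Finset.sum_range_succ']
    obtain ⟨L, h2⟩ := Finset.card_pos.1 (Nat.pos_of_mul_pos_right hpos')
    obtain ⟨-, -, h2⟩ := mem_subspacesBetween.1 h2
    rw [← hL L h2, Nat.mul_div_cancel _ hpos]
    refine Nat.pos_of_mul_pos_right (b := (Nat.card K + 1) * (Nat.card K ^ 2 + Nat.card K + 1)) ?_
    rw [hL L h2]
    simp [Finset.sum_range_succ']
  have hflags := card_subspacesBetween_mul (A := ⊥) (C := (⊤ : Submodule K V)) (d := 2) (e := 5)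
    (r := c) (s := (Nat.card K ^ 2 + 1) * ∑ i ∈ Finset.range 5, Nat.card K ^ i)
    (fun X hX => hc X (mem_subspacesBetween.1 hX).2.2) (fun Y hY => by
      have h1 := card_subspacesBetween_add_two (bot_le (a := Y)) (finrank_bot K V)
        (m := 4) ((mem_subspacesBetween.1 hY).2.2)
      refine Nat.eq_of_mul_eq_mul_right (Nat.succ_pos (Nat.card K)) (h1.trans ?_)
      simp only [Finset.sum_range_succ, Finset.sum_range_zero, Nat.succ_eq_add_one]
      ring)
  have hsum : ∑ U ∈ subspacesBetween ⊥ (⊤ : Submodule K V) 5, (B.filter (· ≤ U)).card =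
      B.card * c := by
    refine (Finset.sum_card_bipartiteAbove_eq_sum_card_bipartiteBelow
      (fun U L => L ≤ U)).trans (Finset.sum_const_nat fun L hL => ?_)
    rw [← hc L (h.finrank_eq L hL)]
    congr 1
    ext U
    simp [Finset.mem_bipartiteBelow, and_comm]
  have hle := Finset.card_nsmul_le_sum (subspacesBetween ⊥ (⊤ : Submodule K V) 5)
    (fun U => (B.filter (· ≤ U)).card) (Nat.card K ^ 4 + 2 * Nat.card K ^ 2 + Nat.card K + 1)
    (fun U hU => (h.filter_le U).le_card (mem_subspacesBetween.1 hU).2.2)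
  rw [hsum, smul_eq_mul] at hle
  have h4 : ∑ i ∈ Finset.range 4, Nat.card K ^ i = (Nat.card K ^ 2 + 1) * (Nat.card K + 1) := by
    simp only [Finset.sum_range_succ, Finset.sum_range_zero]
    ring
  rw [← hlines, h4]
  refine Nat.le_of_mul_le_mul_right (c := c) ?_ hc0
  generalize Nat.card K ^ 4 + 2 * Nat.card K ^ 2 + Nat.card K + 1 = f at *
  generalize ∑ i ∈ Finset.range 5, Nat.card K ^ i = t at *
  calc _ = (subspacesBetween ⊥ (⊤ : Submodule K V) 2).card * c * ((Nat.card K + 1) * f) := by ring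
    _ = (subspacesBetween ⊥ (⊤ : Submodule K V) 5).card * f *
        ((Nat.card K ^ 2 + 1) * t * (Nat.card K + 1)) := by rw [hflags]; ring
    _ ≤ B.card * c * ((Nat.card K ^ 2 + 1) * t * (Nat.card K + 1)) :=
      Nat.mul_le_mul_right _ hle
    _ = _ := by ring

end Averaging

/-! ### Real estimates and the final statement. -/

/-- This is the second bound with N = q^n and denominators cleared. It needs N ≥ q^5: for n = 4 the
simplified expression is one larger than the first bound. -/
theorem lineBlocking_bound_ge {q N : ℝ} (hq : 2 ≤ q) (hN : q ^ 5 ≤ N) :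
    N ^ 2 * (q ^ 4 + 2 * q ^ 2 + q + 2) * ((q ^ 5 - 1) * (q ^ 4 - 1)) ≤
      q ^ 8 * ((N * q - 1) * (N - 1) * (q ^ 4 + 2 * q ^ 2 + q + 1)) := by
  have hid : q ^ 8 * ((N * q - 1) * (N - 1) * (q ^ 4 + 2 * q ^ 2 + q + 1)) -
      N ^ 2 * (q ^ 4 + 2 * q ^ 2 + q + 2) * ((q ^ 5 - 1) * (q ^ 4 - 1)) =
      N * ((N - q ^ 5) *
        (q ^ 8 + 2 * q ^ 7 + 3 * q ^ 6 + 3 * q ^ 5 + q ^ 4 - 2 * q ^ 2 - q - 2)) +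
      N * q ^ 5 * (q ^ 7 + q ^ 6 - q ^ 4 - q ^ 3 - 2 * q ^ 2 - q - 2) +
      q ^ 8 * (q ^ 4 + 2 * q ^ 2 + q + 1) := by ring
  have hN0 : 0 ≤ N := le_trans (by positivity) hN
  -- Expanded in t = q - 2, the two polynomial factors have only nonnegative coefficients.
  obtain ⟨t, ht, rfl⟩ : ∃ t : ℝ, 0 ≤ t ∧ q = t + 2 := ⟨q - 2, by linarith, by ring⟩
  have h1 : 0 ≤ (t + 2) ^ 8 + 2 * (t + 2) ^ 7 + 3 * (t + 2) ^ 6 + 3 * (t + 2) ^ 5 + (t + 2) ^ 4 -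
      2 * (t + 2) ^ 2 - (t + 2) - 2 := by
    ring_nf; positivity
  have h2 : 0 ≤ (t + 2) ^ 7 + (t + 2) ^ 6 - (t + 2) ^ 4 - (t + 2) ^ 3 - 2 * (t + 2) ^ 2 -
      (t + 2) - 2 := by
    ring_nf; positivity
  have h3 : 0 ≤ N - (t + 2) ^ 5 := by linarith
  rw [← sub_nonneg, hid]
  positivity

theorem mainTheorem7 (K : Type*) [Field K] [Fintype K] (q : ℕ) (hq : Fintype.card K = q)
    (n : ℕ) (hn : 4 ≤ n) :
    (minLineBlocking K n : ℝ) ≥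
        ((q : ℝ) ^ (n + 1) - 1) * ((q : ℝ) ^ n - 1) *
          (((q : ℝ) ^ 4 + 2 * (q : ℝ) ^ 2 + (q : ℝ) + 1) /
            (((q : ℝ) ^ 5 - 1) * ((q : ℝ) ^ 4 - 1))) ∧
      (5 ≤ n →
        (minLineBlocking K n : ℝ) ≥
          (q : ℝ) ^ (2 * n - 4) + 2 * (q : ℝ) ^ (2 * n - 6) + (q : ℝ) ^ (2 * n - 7) +
            2 * (q : ℝ) ^ (2 * n - 8)) := by
  have hq2 : 2 ≤ q := hq ▸ Fintype.one_lt_card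
  have hqK : Nat.card K = q := Nat.card_eq_fintype_card.trans hq
  obtain ⟨B, ⟨hB2, hB⟩, hcard⟩ := exists_card_eq_minLineBlocking K n
  have hblock : BlocksPlanesOf B ⊤ := ⟨hB2, fun _ _ => le_top, fun E _ hE => hB E hE⟩
  have hmain := hblock.mul_le_card_mul hn (by simp)
  rw [hqK, hcard] at hmain
  have hgeom : ∀ m : ℕ, (∑ i ∈ Finset.range m, (q : ℝ) ^ i) * ((q : ℝ) - 1) = (q : ℝ) ^ m - 1 :=
    fun m => geom_sum_mul _ m
  have hqR : (2 : ℝ) ≤ q := by exact_mod_cast hq2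
  have h5 : 0 < (q : ℝ) ^ 5 - 1 := sub_pos.2 (one_lt_pow₀ (by linarith) (by norm_num))
  have h4 : 0 < (q : ℝ) ^ 4 - 1 := sub_pos.2 (one_lt_pow₀ (by linarith) (by norm_num))
  have hfirst : ((q : ℝ) ^ (n + 1) - 1) * ((q : ℝ) ^ n - 1) *
      (((q : ℝ) ^ 4 + 2 * (q : ℝ) ^ 2 + (q : ℝ) + 1) /
        (((q : ℝ) ^ 5 - 1) * ((q : ℝ) ^ 4 - 1))) ≤ minLineBlocking K n := by
    rw [← mul_div_assoc, div_le_iff₀ (by positivity), ← hgeom, ← hgeom, ← hgeom, ← hgeom]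
    have hR : (∑ i ∈ Finset.range (n + 1), (q : ℝ) ^ i) * (∑ i ∈ Finset.range n, (q : ℝ) ^ i) *
        ((q : ℝ) ^ 4 + 2 * (q : ℝ) ^ 2 + (q : ℝ) + 1) ≤ (minLineBlocking K n : ℝ) *
        ((∑ i ∈ Finset.range 5, (q : ℝ) ^ i) * ∑ i ∈ Finset.range 4, (q : ℝ) ^ i) := by
      exact_mod_cast hmain
    have := mul_le_mul_of_nonneg_right hR (sq_nonneg ((q : ℝ) - 1))
    linarith
  refine ⟨hfirst, fun hn5 => ge_iff_le.2 (le_trans ?_ hfirst)⟩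
  rw [← mul_div_assoc, le_div_iff₀ (by positivity)]
  -- Multiplying by q^8 removes the subtractions in the exponents, which are not truncated since 2n
  -- ≥ 10.
  have hpow : ∀ j, j ≤ 8 → (q : ℝ) ^ 8 * (q : ℝ) ^ (2 * n - j) =
      ((q : ℝ) ^ n) ^ 2 * (q : ℝ) ^ (8 - j) := by
    intro j hj
    rw [← pow_add, ← pow_mul, ← pow_add]
    congr 1; omega
  have hbound := lineBlocking_bound_ge hqR (pow_le_pow_right₀ (by linarith) hn5)
  refine le_of_mul_le_mul_left (le_trans (le_of_eq ?_) hbound) (pow_pos (by linarith) 8)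
  rw [← mul_assoc, mul_add, mul_add, mul_add, mul_left_comm _ 2, mul_left_comm _ 2,
    hpow 4 (by norm_num), hpow 6 (by norm_num), hpow 7 (by norm_num), hpow 8 (by norm_num)]
  ring
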